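/- Let $r>1$ be an irrational real number and let \[P_r=\{\lfloor nr\rfloor : n\in\mathbb{Z}\setminus\{0\}\}.\] Let $X\subseteq\mathbb{Z}$ be an infinite set that is first-order definable (with parameters) in the structure $(\mathbb{Z},+,P_r)$, that is, in the abelian group of integers expanded by a unary predicate for $P_r$. Then there is a positive integer $N$, depending on $X$, such that for every $x\in X$ at least one of the integers $x+1,x+2,\dots,x+N$ is in $X$. -/

import Mathlib

open FirstOrder

namespace BeattyExpansion

/-- The set `P_r = {⌊n r⌋ : n ∈ ℤ, n ≠ 0}`. -/
def beattySet (r : ℝ) : Set ℤ :=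
  {x | ∃ n : ℤ, n ≠ 0 ∧ x = ⌊(n : ℝ) * r⌋}

/-- Function symbols of the language `{+, -, 0, 1, P}`; `neg` is the unary minus. -/
inductive Func : ℕ → Type
  | zero : Func 0
  | one : Func 0
  | neg : Func 1
  | add : Func 2

/-- Relation symbols of the language `{+, -, 0, 1, P}`: one unary predicate `P`. -/
inductive Rel : ℕ → Type
  | P : Rel 1

/-- The language `{+, -, 0, 1, P}` of abelian groups with a distinguished element, expanded by a
unary predicate. -/
def langP : Language where
  Functions := Func
  Relations := Rel

/-- The structure `(ℤ, +, -, 0, 1, P_r)`: the symbols have their usual meaning in `ℤ`, and `P` is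
interpreted as the set `P_r`. -/
@[reducible] def structureP (r : ℝ) : langP.Structure ℤ where
  funMap {_} f v :=
    match f, v with
    | Func.zero, _ => 0
    | Func.one, _ => 1
    | Func.neg, v => -(v 0)
    | Func.add, v => v 0 + v 1
  RelMap {_} R v :=
    match R, v with
    | Rel.P, v => v 0 ∈ beattySet r

/-- `X ⊆ ℤ` is first-order definable, with parameters from `ℤ` allowed, in
`(ℤ, +, -, 0, 1, P_r)`. -/
def IsDefinable (r : ℝ) (X : Set ℤ) : Prop :=
  letI : langP.Structure ℤ := structureP r
  (Set.univ : Set ℤ).Definable₁ langP X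

end BeattyExpansion

namespace BeattyExpansion

/-! Put `α = r⁻¹`. Through `val α`, `ℤ × ℤ` is a dense ordered subgroup of `ℝ`, and `lift α`
identifies `ℤ` with its points in `[0, 1)`. Membership in `P_r` becomes a sign condition on affine
forms in the lifts, so a back-and-forth argument (`exists_same_cut`, `exists_indist_extend`) shows
that every definable set is tame: it is cut out by congruences on the lifts and signs of finitely
many affine forms (`isTame_setOf_realize`). In one variable only finitely many points are zeros of a
nonconstant form. An infinite definable set has some other point, hence contains all integers in one
congruence class of lifts whose fractional parts fill a small interval. Such integers recur with
bounded gaps (`IsTame.syndetic_of_infinite`). -/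

/-- The embedding of `ℤ` into `ℤ × ℤ` such that `val α ∘ lift α` is the fractional part of
`α * x`. -/
noncomputable def lift (α : ℝ) (x : ℤ) : ℤ × ℤ := (x, -⌊α * x⌋)

/-- The homomorphism `(p, q) ↦ α p + q` from `ℤ × ℤ` to `ℝ`. -/
noncomputable def val (α : ℝ) : ℤ × ℤ →+ ℝ where
  toFun p := α * p.1 + p.2
  map_zero' := by simp
  map_add' p q := by push_cast [Prod.fst_add, Prod.snd_add]; ring

theorem val_apply (α : ℝ) (p : ℤ × ℤ) : val α p = α * p.1 + p.2 := rfl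

theorem val_smul (α : ℝ) (n : ℤ) (p : ℤ × ℤ) : val α (n • p) = n * val α p := by
  rw [map_zsmul, zsmul_eq_mul]

theorem val_lift (α : ℝ) (x : ℤ) : val α (lift α x) = Int.fract (α * x) := by
  simp [val_apply, lift, Int.fract, sub_eq_add_neg]

theorem val_injective {α : ℝ} (hα : Irrational α) : Function.Injective (val α) := by
  rw [injective_iff_map_eq_zero]
  rintro ⟨p, q⟩ h
  rw [val_apply] at h
  have hp : p = 0 := by
    by_contra hp
    exact ((hα.mul_intCast hp).add_intCast q).ne_int 0 (by simpa using h)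
  subst hp
  simpa using h

theorem lift_fst_eq {α : ℝ} {h : ℤ × ℤ} (h0 : 0 ≤ val α h) (h1 : val α h < 1) :
    lift α h.1 = h := by
  rw [val_apply] at h0 h1
  have : ⌊α * h.1⌋ = -h.2 := by
    rw [Int.floor_eq_iff]; push_cast; constructor <;> linarith
  ext <;> simp [lift, this]

theorem denseRange_val {α : ℝ} (hα : Irrational α) : DenseRange (val α) := by
  have h : Dense (AddSubgroup.closure {α, 1} : Set ℝ) :=
    dense_addSubgroupClosure_pair_iff.2 (by simpa using hα)
  refine h.mono ?_
  rw [← AddMonoidHom.coe_range, SetLike.coe_subset_coe, AddSubgroup.closure_le]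
  rintro x (rfl | rfl)
  · exact ⟨(1, 0), by simp [val_apply]⟩
  · exact ⟨(0, 1), by simp [val_apply]⟩

/-- Every coset of `m (ℤ × ℤ)` is dense in `ℝ`. -/
theorem exists_val_mem {α : ℝ} (hα : Irrational α) {m : ℤ} (hm : 0 < m) (h : ℤ × ℤ)
    {U : Set ℝ} (hU : IsOpen U) (hne : U.Nonempty) : ∃ d : ℤ × ℤ, val α (h + m • d) ∈ U := by
  have hm' : (m : ℝ) ≠ 0 := by exact_mod_cast hm.ne'
  obtain ⟨u, hu⟩ := hne
  have hopen : IsOpen ((fun t : ℝ => val α h + m * t) ⁻¹' U) := hU.preimage (by fun_prop)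
  obtain ⟨d, hd⟩ := (denseRange_val hα).exists_mem_open hopen
    ⟨(u - val α h) / m, by simpa [mul_div_cancel₀ _ hm'] using hu⟩
  exact ⟨d, by rwa [map_add, val_smul]⟩

/-! ### Affine forms, indistinguishable tuples and tame sets. -/

/-- Affine forms over `ℤ × ℤ` in the variables `ι`, with integer coefficients. -/
abbrev Form (ι : Type*) := (ι → ℤ) × (ℤ × ℤ)

/-- The value of an affine form at the lift of a tuple of integers. -/
noncomputable def eval {ι : Type*} [Fintype ι] (α : ℝ) (x : ι → ℤ) : Form ι →+ ℤ × ℤ where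
  toFun L := ∑ i, L.1 i • lift α (x i) + L.2
  map_zero' := by simp
  map_add' L M := by
    simp only [Prod.fst_add, Prod.snd_add, Pi.add_apply, add_smul, Finset.sum_add_distrib]
    abel

theorem eval_apply {ι : Type*} [Fintype ι] (α : ℝ) (x : ι → ℤ) (L : Form ι) :
    eval α x L = ∑ i, L.1 i • lift α (x i) + L.2 := rfl

/-- Two tuples have congruent lifts modulo `m`, and the forms in `F` have the same sign at both. -/
def Indist {ι : Type*} [Fintype ι] (α : ℝ) (m : ℤ) (F : Finset (Form ι)) (x x' : ι → ℤ) : Prop :=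
  (∀ i, ∃ d, lift α (x' i) = lift α (x i) + m • d) ∧
    ∀ L ∈ F, SignType.sign (val α (eval α x L)) = SignType.sign (val α (eval α x' L))

section Indist

variable {ι : Type*} [Fintype ι] {α : ℝ} {m m' : ℤ} {F F' : Finset (Form ι)} {x x' : ι → ℤ}

theorem Indist.symm (h : Indist α m F x x') : Indist α m F x' x :=
  ⟨fun i => let ⟨d, hd⟩ := h.1 i; ⟨-d, by rw [hd]; simp⟩, fun L hL => (h.2 L hL).symm⟩

theorem Indist.mono (h : Indist α m' F' x x') (hm : m ∣ m') (hF : F ⊆ F') : Indist α m F x x' := by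
  obtain ⟨k, rfl⟩ := hm
  exact ⟨fun i => let ⟨d, hd⟩ := h.1 i; ⟨k • d, by rw [hd, mul_smul]⟩,
    fun L hL => h.2 L (hF hL)⟩

theorem Indist.exists_eval (h : Indist α m F x x') (L : Form ι) :
    ∃ d, eval α x' L = eval α x L + m • d := by
  choose d hd using h.1
  refine ⟨∑ i, L.1 i • d i, ?_⟩
  simp only [eval_apply, hd, smul_add, Finset.sum_add_distrib, Finset.smul_sum]
  simp only [smul_comm m]
  abel

end Indist

/-- Membership is decided by the residues of the lifts and the signs of finitely many forms. -/
def IsTame {ι : Type*} [Fintype ι] (α : ℝ) (S : Set (ι → ℤ)) : Prop :=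
  ∃ m : ℤ, 0 < m ∧ ∃ F : Finset (Form ι), ∀ x x', Indist α m F x x' → x ∈ S → x' ∈ S

theorem IsTame.imp {ι : Type*} [Fintype ι] {α : ℝ} {S T : Set (ι → ℤ)} (hS : IsTame α S)
    (hT : IsTame α T) : IsTame α {x | x ∈ S → x ∈ T} := by
  classical
  obtain ⟨m, hm, F, h⟩ := hS
  obtain ⟨m', hm', F', h'⟩ := hT
  refine ⟨m * m', mul_pos hm hm', F ∪ F', fun x x' hx hxS hx'S => ?_⟩
  exact h' x x' (hx.mono (dvd_mul_left _ _) Finset.subset_union_right)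
    (hxS (h x' x (hx.mono (dvd_mul_right _ _) Finset.subset_union_left).symm hx'S))

/-! ### Back-and-forth: eliminating a quantifier. -/

/-- If the cut points `f t` and `f' t` are ordered in the same way and congruent modulo `D * m`,
then every position of `D • h` relative to the `f t` is realised relative to the `f' t`. -/
theorem exists_same_cut {α : ℝ} (hα : Irrational α) {T : Type*} (G : Finset T) {D m : ℤ}
    (hD : 0 < D) (hm : 0 < m) (f f' : T → ℤ × ℤ)
    (hmod : ∀ t ∈ G, ∃ d, f' t = f t + (D * m) • d)
    (hord : ∀ s ∈ G, ∀ t ∈ G, SignType.sign (val α (f s - f t)) =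
      SignType.sign (val α (f' s - f' t))) (h : ℤ × ℤ) :
    ∃ d, ∀ t ∈ G, SignType.sign (val α (D • h - f t)) =
      SignType.sign (val α (D • (h + m • d) - f' t)) := by
  classical
  have hD' : (0 : ℝ) < D := by exact_mod_cast hD
  -- If `D • h` is itself a cut point, the witness is forced, and congruence modulo `D * m` supplies
  -- it. Otherwise the conditions are open and a dense coset meets them.
  by_cases heq : ∃ s ∈ G, D • h = f s
  · obtain ⟨s, hs, hs'⟩ := heq
    obtain ⟨d, hd⟩ := hmod s hs
    refine ⟨d, fun t ht => ?_⟩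
    rw [hs', hord s hs t ht, hd, ← hs', smul_add, mul_smul]
  push Not at heq
  have hne : ∀ t ∈ G, val α (f t) ≠ D * val α h := fun t ht e =>
    heq t ht (val_injective hα (by rw [val_smul, e]))
  have hlt : ∀ s ∈ G, ∀ t ∈ G, val α (f s) < val α (f t) → val α (f' s) < val α (f' t) := by
    intro s hs t ht hst
    have := hord s hs t ht
    rw [(val α).map_sub, (val α).map_sub, sign_neg (sub_neg.2 hst)] at this
    exact sub_neg.1 (sign_eq_neg_one_iff.1 this.symm)
  obtain ⟨u, hlo, hhi⟩ := Order.exists_between_finsets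
    ((G.filter fun t => val α (f t) < D * val α h).image fun t => val α (f' t))
    ((G.filter fun t => D * val α h < val α (f t)).image fun t => val α (f' t)) (by
      simp only [Finset.mem_image, Finset.mem_filter]
      rintro _ ⟨s, ⟨hs, hs'⟩, rfl⟩ _ ⟨t, ⟨ht, ht'⟩, rfl⟩
      exact hlt s hs t ht (hs'.trans ht'))
  simp only [Finset.mem_image, Finset.mem_filter, forall_exists_index, and_imp] at hlo hhi
  let U : Set ℝ := (⋂ t ∈ G.filter fun t => val α (f t) < D * val α h, {y | val α (f' t) < D * y}) ∩
    ⋂ t ∈ G.filter fun t => D * val α h < val α (f t), {y | D * y < val α (f' t)}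
  have hU : IsOpen U :=
    (isOpen_biInter_finset fun t _ => isOpen_lt (by fun_prop) (by fun_prop)).inter
      (isOpen_biInter_finset fun t _ => isOpen_lt (by fun_prop) (by fun_prop))
  have hmem : ∀ y, y ∈ U ↔ (∀ t ∈ G, val α (f t) < D * val α h → val α (f' t) < D * y) ∧
      ∀ t ∈ G, D * val α h < val α (f t) → D * y < val α (f' t) := by
    simp [U, and_imp]
  obtain ⟨d, hd⟩ := exists_val_mem hα hm h hU ⟨u / D, (hmem _).2 (by
    rw [mul_div_cancel₀ _ hD'.ne']
    exact ⟨fun t ht h => hlo _ t ht h rfl, fun t ht h => hhi _ t ht h rfl⟩)⟩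
  rw [hmem] at hd
  refine ⟨d, fun t ht => ?_⟩
  rw [(val α).map_sub, (val α).map_sub, val_smul, val_smul]
  rcases lt_or_gt_of_ne (hne t ht) with hc | hc
  · rw [sign_pos (sub_pos.2 hc), sign_pos (sub_pos.2 (hd.1 t ht hc))]
  · rw [sign_neg (sub_neg.2 hc), sign_neg (sub_neg.2 (hd.2 t ht hc))]

section Extension

variable {β : Type*} [Fintype β] {n : ℕ}

/-- Append the integer `y` to a tuple. -/
def extend (x : β ⊕ Fin n → ℤ) (y : ℤ) : β ⊕ Fin (n + 1) → ℤ :=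
  Sum.elim (x ∘ Sum.inl) (Fin.snoc (x ∘ Sum.inr) y)

/-- Delete the last variable from an affine form. -/
def restrict (L : Form (β ⊕ Fin (n + 1))) : Form (β ⊕ Fin n) :=
  (Sum.elim (L.1 ∘ Sum.inl) (fun i => L.1 (Sum.inr i.castSucc)), L.2)

/-- The coefficient of the last variable. -/
def lastCoeff (L : Form (β ⊕ Fin (n + 1))) : ℤ := L.1 (Sum.inr (Fin.last n))

theorem eval_extend (α : ℝ) (x : β ⊕ Fin n → ℤ) (y : ℤ) (L : Form (β ⊕ Fin (n + 1))) :
    eval α (extend x y) L = lastCoeff L • lift α y + eval α x (restrict L) := by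
  simp only [eval_apply, Fintype.sum_sum_type, Fin.sum_univ_castSucc, extend, restrict, lastCoeff,
    Sum.elim_inl, Sum.elim_inr, Function.comp_apply, Fin.snoc_castSucc, Fin.snoc_last]
  abel

/-- Indistinguishable tuples can be extended to indistinguishable tuples. -/
theorem exists_indist_extend {α : ℝ} (hα : Irrational α) {m : ℤ} (hm : 0 < m)
    (F : Finset (Form (β ⊕ Fin (n + 1)))) :
    ∃ m' : ℤ, 0 < m' ∧ ∃ F' : Finset (Form (β ⊕ Fin n)), ∀ x x', Indist α m' F' x x' →
      ∀ y, ∃ y', Indist α m F (extend x y) (extend x' y') := by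
  classical
  -- A common multiple of the leading coefficients: each form then compares `D • lift α y` with a
  -- cut point free of `y`.
  let D : ℤ := ∏ L ∈ F.filter fun L => lastCoeff L ≠ 0, |lastCoeff L|
  have hD : 0 < D := Finset.prod_pos fun L hL => abs_pos.2 (Finset.mem_filter.1 hL).2
  have hdvd : ∀ L ∈ F, lastCoeff L ≠ 0 → lastCoeff L ∣ D := fun L hL h =>
    (abs_dvd _ _).1 (Finset.dvd_prod_of_mem _ (Finset.mem_filter.2 ⟨hL, h⟩))
  let cut : Form (β ⊕ Fin (n + 1)) → Form (β ⊕ Fin n) := fun L =>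
    -((D / lastCoeff L) • restrict L)
  -- The cuts `0` and `(0, D)` keep the new point in `[0, 1)`, so that it is the lift of an integer.
  let G : Finset (Form (β ⊕ Fin n)) :=
    insert 0 (insert (0, (0, D)) ((F.filter fun L => lastCoeff L ≠ 0).image cut))
  refine ⟨D * m, mul_pos hD hm, (F.filter fun L => lastCoeff L = 0).image restrict ∪
    (G ×ˢ G).image fun p => p.1 - p.2, fun x x' hx y => ?_⟩
  obtain ⟨d, hd⟩ := exists_same_cut hα G hD hm (eval α x) (eval α x')
    (fun t _ => hx.exists_eval t) (fun s hs t ht => by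
      rw [← map_sub, ← map_sub]
      exact hx.2 _ (Finset.mem_union_right _
        (Finset.mem_image.2 ⟨(s, t), Finset.mk_mem_product hs ht, rfl⟩))) (lift α y)
  have hD' : (0 : ℝ) < D := by exact_mod_cast hD
  have h0 : 0 ≤ val α (lift α y + m • d) := by
    have h := hd 0 (by simp [G])
    simp only [map_zero, sub_zero, val_smul] at h
    have hy : 0 ≤ D * val α (lift α y) := by
      rw [val_lift]; exact mul_nonneg hD'.le (Int.fract_nonneg _)
    rw [← sign_nonneg_iff, h, sign_nonneg_iff] at hy
    exact nonneg_of_mul_nonneg_right hy hD'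
  have h1 : val α (lift α y + m • d) < 1 := by
    have h := hd (0, (0, D)) (by simp [G])
    have hc : ∀ z : β ⊕ Fin n → ℤ, val α (eval α z (0, (0, D))) = D := fun z => by
      simp [eval_apply, val_apply]
    rw [(val α).map_sub, (val α).map_sub, hc, hc, val_smul, val_smul] at h
    have hy : D * val α (lift α y) - D < 0 := by
      rw [val_lift]; nlinarith [Int.fract_lt_one (α * y)]
    rw [sign_neg hy, eq_comm, sign_eq_neg_one_iff] at h
    nlinarith
  have hy' := lift_fst_eq h0 h1
  refine ⟨(lift α y + m • d).1, ?_, fun L hL => ?_⟩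
  · rintro (i | i)
    · obtain ⟨d, hd⟩ := hx.1 (Sum.inl i)
      exact ⟨D • d, by rw [smul_smul, mul_comm]; exact hd⟩
    · refine Fin.lastCases ?_ (fun i => ?_) i
      · exact ⟨d, by simpa [extend] using hy'⟩
      · obtain ⟨d, hd⟩ := hx.1 (Sum.inr i)
        refine ⟨D • d, ?_⟩
        rw [smul_smul, mul_comm]
        simpa [extend] using hd
  · rw [eval_extend, eval_extend, hy']
    by_cases hL0 : lastCoeff L = 0
    · rw [hL0, zero_smul, zero_smul, zero_add, zero_add]
      exact hx.2 _ (Finset.mem_union_left _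
        (Finset.mem_image_of_mem _ (Finset.mem_filter.2 ⟨hL, hL0⟩)))
    · obtain ⟨k, hk⟩ := hdvd L hL hL0
      have hk0 : k ≠ 0 := by rintro rfl; simp [hk] at hD
      have hkD : D / lastCoeff L = k := by rw [hk, Int.mul_ediv_cancel_left _ hL0]
      have h := hd (cut L) (by
        simp only [G, Finset.mem_insert]
        exact .inr (.inr (Finset.mem_image_of_mem _ (Finset.mem_filter.2 ⟨hL, hL0⟩))))
      have key : ∀ (z : β ⊕ Fin n → ℤ) (p : ℤ × ℤ), D • p - eval α z (cut L) =
          k • (lastCoeff L • p + eval α z (restrict L)) := fun z p => by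
        simp only [cut, hkD, map_neg, map_zsmul, sub_neg_eq_add, smul_add, smul_smul]
        rw [hk, mul_comm]
      rw [key, key, val_smul, val_smul, sign_mul, sign_mul] at h
      exact mul_left_cancel₀ (by simpa [sign_eq_zero_iff] using hk0) h

theorem IsTame.forall_extend {α : ℝ} (hα : Irrational α) {S : Set (β ⊕ Fin (n + 1) → ℤ)}
    (hS : IsTame α S) : IsTame α {x | ∀ y, extend x y ∈ S} := by
  obtain ⟨m, hm, F, h⟩ := hS
  obtain ⟨m', hm', F', h'⟩ := exists_indist_extend hα hm F
  refine ⟨m', hm', F', fun x x' hx hxS y' => ?_⟩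
  obtain ⟨y, hy⟩ := h' x' x hx.symm y'
  exact h _ _ hy.symm (hxS y)

end Extension

/-! ### Atomic formulas are tame. -/

section Atomic

variable {ι : Type*} [Fintype ι] {α : ℝ}

theorem abs_sum_floor_sub_le (α : ℝ) (b : ι → ℤ) (c : ℤ) (x : ι → ℤ) :
    |((∑ i, b i * ⌊α * x i⌋ : ℤ) : ℝ) - α * ((∑ i, b i * x i + c : ℤ) : ℝ)| ≤
      ∑ i, |(b i : ℝ)| + |α * c| := by
  have : ((∑ i, b i * ⌊α * x i⌋ : ℤ) : ℝ) - α * ((∑ i, b i * x i + c : ℤ) : ℝ) =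
      -(∑ i, b i * Int.fract (α * x i) + α * c) := by
    push_cast
    simp only [Int.fract, mul_sub, Finset.sum_sub_distrib, mul_add, Finset.mul_sum]
    rw [Finset.sum_congr rfl fun i _ => mul_left_comm α (b i : ℝ) (x i)]
    ring
  rw [this, abs_neg]
  refine (abs_add_le _ _).trans (add_le_add_left ((Finset.abs_sum_le_sum_abs _ _).trans
    (Finset.sum_le_sum fun i _ => ?_)) _)
  rw [abs_mul, Int.abs_fract]
  exact mul_le_of_le_one_right (abs_nonneg _) (Int.fract_lt_one _).le

/-- The condition on `t = ∑ i, b i * x i + c` that some integer translate of `α * t` has sign `s`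
and the same translate of `α * (t + 1)` is positive is tame. -/
theorem isTame_exists_translate (hα : 0 < α) {s : SignType} (hs : s ≤ 0) (b : ι → ℤ) (c : ℤ) :
    IsTame α {x : ι → ℤ | ∃ k : ℤ,
      SignType.sign (α * ((∑ i, b i * x i + c : ℤ) : ℝ) + k) = s ∧
        0 < α * (((∑ i, b i * x i + c : ℤ) : ℝ) + 1) + k} := by
  classical
  -- The two conditions put `α * t + k` in `(-α, 0]`, and `K x` is within bounded distance of `α *
  -- t`. Hence `k + K x` takes finitely many values, one pair of forms for each.
  obtain ⟨B, hB⟩ := exists_nat_ge (∑ i, |(b i : ℝ)| + |α * c| + α)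
  let K : (ι → ℤ) → ℤ := fun x => ∑ i, b i * ⌊α * x i⌋
  have hval : ∀ (x : ι → ℤ) (e j : ℤ), val α (eval α x (b, (c + e, j))) =
      α * (((∑ i, b i * x i + c : ℤ) : ℝ) + e) + (j - K x : ℤ) := by
    intro x e j
    simp only [eval_apply, val_apply, lift, Prod.fst_add, Prod.snd_add, Prod.fst_sum, Prod.snd_sum,
      Prod.smul_fst, Prod.smul_snd, smul_eq_mul, mul_neg, Finset.sum_neg_distrib, K]
    push_cast
    ring
  refine ⟨1, one_pos, (Finset.Icc (-B : ℤ) B ×ˢ {0, 1}).image fun p => (b, (c + p.2, p.1)), ?_⟩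
  rintro x x' hx ⟨k, hk, hk'⟩
  have hle : α * ((∑ i, b i * x i + c : ℤ) : ℝ) + k ≤ 0 := by
    rw [← sign_nonpos_iff, hk]; exact hs
  have hj : k + K x ∈ Finset.Icc (-B : ℤ) B := by
    have h := abs_le.1 (abs_sum_floor_sub_le α b c x)
    have h1 : ((k + K x : ℤ) : ℝ) ≤ B := by push_cast; linarith [h.2]
    have h2 : -(B : ℝ) ≤ (k + K x : ℤ) := by push_cast; linarith [h.1]
    rw [Finset.mem_Icc]
    exact ⟨by exact_mod_cast h2, by exact_mod_cast h1⟩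
  have h0 := hx.2 (b, (c + 0, k + K x)) (Finset.mem_image.2 ⟨(_, 0), by simpa using hj, rfl⟩)
  have h1 := hx.2 (b, (c + 1, k + K x)) (Finset.mem_image.2 ⟨(_, 1), by simpa using hj, rfl⟩)
  rw [hval, hval] at h0 h1
  simp only [add_sub_cancel_right, Int.cast_zero, Int.cast_one, add_zero] at h0 h1
  refine ⟨k + K x - K x', h0 ▸ hk, ?_⟩
  rw [sign_pos hk', eq_comm, sign_eq_one_iff] at h1
  exact h1

/-- By irrationality, `α * t` is an integer only for `t = 0`. -/
theorem isTame_eq_zero (hα : Irrational α) (hα0 : 0 < α) (b : ι → ℤ) (c : ℤ) :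
    IsTame α {x : ι → ℤ | ∑ i, b i * x i + c = 0} := by
  convert isTame_exists_translate hα0 le_rfl b c using 3 with x
  refine ⟨fun h => ⟨0, by simp [h], by simpa [h] using hα0⟩, ?_⟩
  rintro ⟨k, hk, -⟩
  have h : val α (∑ i, b i * x i + c, k) = val α 0 := by
    rw [map_zero]; exact sign_eq_zero_iff.1 hk
  exact congrArg Prod.fst (val_injective hα h)

/-- Take `k = -n`. As `n * r` is irrational, `z < n * r < z + 1` is strict on both sides, and
strictness also rules out `n = 0`. -/
theorem mem_beattySet_iff {r : ℝ} (hr : 1 < r) (hirr : Irrational r) (z : ℤ) :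
    z ∈ beattySet r ↔
      ∃ k : ℤ, SignType.sign (r⁻¹ * (z : ℝ) + k) = -1 ∧ 0 < r⁻¹ * ((z : ℝ) + 1) + k := by
  have hr0 : 0 < r := one_pos.trans hr
  simp only [sign_eq_neg_one_iff]
  constructor
  · rintro ⟨n, hn, hz⟩
    rw [eq_comm, Int.floor_eq_iff] at hz
    have hne : (z : ℝ) ≠ n * r := fun h => (hirr.intCast_mul hn).ne_int z h.symm
    have h1 : (z : ℝ) < n * r := lt_of_le_of_ne hz.1 hne
    refine ⟨-n, ?_, ?_⟩
    · rw [← div_eq_inv_mul]; push_cast; linarith [(div_lt_iff₀ hr0).2 h1]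
    · rw [← div_eq_inv_mul]; push_cast; linarith [(lt_div_iff₀ hr0).2 hz.2]
  · rintro ⟨k, h1, h2⟩
    rw [← div_eq_inv_mul] at h1 h2
    have h1' : (z : ℝ) < -k * r := (div_lt_iff₀ hr0).1 (by linarith)
    have h2' : -k * r < z + 1 := (lt_div_iff₀ hr0).1 (by linarith)
    refine ⟨-k, ?_, ?_⟩
    · intro hk
      have hk : k = 0 := by omega
      subst hk
      simp only [Int.cast_zero, neg_zero, zero_mul] at h1' h2'
      have h3 : z < 0 := by exact_mod_cast h1'
      have h4 : 0 < z + 1 := by exact_mod_cast h2'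
      omega
    · rw [eq_comm, Int.floor_eq_iff]
      push_cast
      exact ⟨h1'.le, h2'⟩

end Atomic

/-! ### Bounded gaps. -/

/-- The integers `w` for which `α * w` is close to an integer form a syndetic set. -/
theorem exists_bound_near_int {α : ℝ} (hα : Irrational α) {δ : ℝ} (hδ : 0 < δ) :
    ∃ B : ℕ, ∀ z : ℤ, ∃ k b : ℤ, 1 ≤ k ∧ k ≤ B ∧ |val α (z + k, b)| < δ := by
  obtain ⟨M, hM⟩ := exists_nat_one_div_lt hδ
  have hM0 : (0 : ℝ) < M + 1 := by positivity
  have hp : ∀ j : ℕ, ∃ p : ℤ × ℤ, val α p ∈ Set.Ioo ((j : ℝ) / (M + 1)) ((j + 1) / (M + 1)) :=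
    fun j => by
      obtain ⟨p, hp⟩ := (denseRange_val hα).exists_mem_open
        (isOpen_Ioo (a := (j : ℝ) / (M + 1)) (b := (j + 1) / (M + 1)))
        (Set.nonempty_Ioo.2 (by gcongr; linarith))
      exact ⟨p, hp⟩
  choose p hp using hp
  -- Subtracting from `lift α (z + C + 1)` the `p j` in the same cell of length `1 / (M + 1)` leaves
  -- a value below `δ`; the shift `C + 1` makes `k` positive.
  let C : ℤ := ∑ j ∈ Finset.range (M + 1), |(p j).1|
  have hC : 0 ≤ C := Finset.sum_nonneg fun _ _ => abs_nonneg _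
  refine ⟨(2 * C + 1).toNat, fun z => ?_⟩
  rw [Int.toNat_of_nonneg (by omega)]
  let t : ℝ := val α (lift α (z + C + 1))
  have ht0 : 0 ≤ t := by simp only [t, val_lift]; exact Int.fract_nonneg _
  have ht1 : t < 1 := by simp only [t, val_lift]; exact Int.fract_lt_one _
  let j : ℕ := ⌊t * (M + 1)⌋₊
  have hj : j ∈ Finset.range (M + 1) := by
    rw [Finset.mem_range, Nat.floor_lt (by positivity)]
    push_cast
    nlinarith
  have hpj := abs_le.1 (Finset.single_le_sum (f := fun j => |(p j).1|)
    (fun _ _ => abs_nonneg _) hj)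
  have hjt : (j : ℝ) / (M + 1) ≤ t := (div_le_iff₀ hM0).2 (Nat.floor_le (by positivity))
  have htj : t < (j + 1) / (M + 1) := (lt_div_iff₀ hM0).2 (Nat.lt_floor_add_one _)
  obtain ⟨h1, h2⟩ := hp j
  rw [add_div] at h2 htj
  refine ⟨C + 1 - (p j).1, -⌊α * (z + C + 1 : ℤ)⌋ - (p j).2, ?_, ?_, ?_⟩
  · have := hpj.2; change _ ≤ C at this; omega
  · have := hpj.1; change -C ≤ _ at this; omega
  · have : val α (z + (C + 1 - (p j).1), -⌊α * (z + C + 1 : ℤ)⌋ - (p j).2) = t - val α (p j) := by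
      simp only [t, val_apply, lift]; push_cast; ring
    rw [this, abs_lt]
    constructor <;> linarith

/-- The trace of a tame set on the diagonal is syndetic as soon as it is infinite. -/
theorem IsTame.syndetic_of_infinite {ι : Type*} [Fintype ι] {α : ℝ} (hα : Irrational α)
    {S : Set (ι → ℤ)} (hS : IsTame α S) (hinf : {x : ℤ | (fun _ => x) ∈ S}.Infinite) :
    ∃ N : ℕ, ∀ z : ℤ, ∃ k : ℤ, 1 ≤ k ∧ k ≤ N ∧ (fun _ => z + k) ∈ S := by
  obtain ⟨m, hm, F, h⟩ := hS
  let c : Form ι → ℤ := fun L => ∑ i, L.1 i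
  have heval : ∀ (L : Form ι) (y : ℤ),
      val α (eval α (fun _ => y) L) = c L * val α (lift α y) + val α L.2 := fun L y => by
    rw [eval_apply, ← Finset.sum_smul, map_add, val_smul]
  have hzero : ∀ L : Form ι,
      {y : ℤ | c L ≠ 0 ∧ val α (eval α (fun _ => y) L) = 0}.Subsingleton := by
    rintro L y ⟨hc, hy⟩ y' ⟨-, hy'⟩
    have hc : (c L : ℝ) ≠ 0 := by exact_mod_cast hc
    rw [heval] at hy hy'
    have : val α (lift α y) = val α (lift α y') := mul_left_cancel₀ hc (by linarith)
    exact congrArg Prod.fst (val_injective hα this)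
  -- Zero is excluded too: its lift lies on the boundary of `[0, 1)`.
  obtain ⟨x, hxS, hx⟩ := (hinf.sdiff ((F.finite_toSet.biUnion fun L _ => (hzero L).finite).union
    (Set.finite_singleton 0))).nonempty
  simp only [Set.mem_union, Set.mem_iUnion, Set.mem_ofPred_eq, Set.mem_singleton_iff, not_or,
    not_exists, not_and, SetLike.mem_coe] at hx
  obtain ⟨hxF, hx0⟩ := hx
  have hpos : 0 < val α (lift α x) := by
    rw [val_lift, Int.fract_pos]
    exact (hα.mul_intCast hx0).ne_int _
  have hlt : val α (lift α x) < 1 := by rw [val_lift]; exact Int.fract_lt_one _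
  have hev : ∀ᶠ t in nhds (val α (lift α x)), (0 < t ∧ t < 1) ∧ ∀ L ∈ F,
      SignType.sign (c L * val α (lift α x) + val α L.2) =
        SignType.sign (c L * t + val α L.2) := by
    refine ((lt_mem_nhds hpos).and (gt_mem_nhds hlt)).and
      ((Filter.eventually_all_finset F).2 fun L hL => ?_)
    by_cases hc : c L = 0
    · simp [hc]
    · have hne := hxF L hL hc
      rw [heval] at hne
      have hcont : ContinuousAt (fun t : ℝ => SignType.sign (c L * t + val α L.2))
          (val α (lift α x)) :=
        (continuousAt_sign_of_ne_zero hne).comp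
          (f := fun t : ℝ => c L * t + val α L.2) (by fun_prop)
      have := hcont.eventually (isOpen_discrete {_} |>.mem_nhds rfl)
      exact this.mono fun t ht => ht.symm
  obtain ⟨ε, hε, hball⟩ := Metric.eventually_nhds_iff.1 hev
  have hm' : (0 : ℝ) < m := by exact_mod_cast hm
  obtain ⟨B, hB⟩ := exists_bound_near_int hα (div_pos hε hm')
  refine ⟨m.toNat * B, fun z => ?_⟩
  obtain ⟨k, b, hk1, hkB, hkb⟩ := hB ((z - x) / m)
  -- Then `x + m * a - z = m * k - (z - x) % m`, which lies in `[1, m * B]` because `k ≥ 1`.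
  let a : ℤ := (z - x) / m + k
  have hq := Int.mul_ediv_add_emod (z - x) m
  have hr0 := Int.emod_nonneg (z - x) hm.ne'
  have hrm := Int.emod_lt_of_pos (z - x) hm
  have hdist : dist (val α (lift α x + m • (a, b))) (val α (lift α x)) < ε := by
    rw [map_add, val_smul, Real.dist_eq, add_sub_cancel_left, abs_mul, abs_of_pos hm']
    rw [lt_div_iff₀ hm'] at hkb
    linarith
  obtain ⟨⟨h0, h1⟩, hF⟩ := hball hdist
  have hlift := lift_fst_eq h0.le h1
  have hfst : (lift α x + m • (a, b)).1 = x + m * a := rfl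
  rw [hfst] at hlift
  refine ⟨x + m * a - z, ?_, ?_, ?_⟩
  · have : m * 1 ≤ m * k := by gcongr
    simp only [a, mul_add]
    omega
  · have : m * k ≤ m * B := by gcongr
    push_cast [Int.toNat_of_nonneg hm.le]
    simp only [a, mul_add]
    omega
  · rw [add_sub_cancel]
    refine h _ _ ⟨fun _ => ⟨(a, b), hlift⟩, fun L hL => ?_⟩ hxS
    rw [heval, heval, hlift]
    exact hF L hL

/-! ### From formulas to tame sets. -/

section Definable

open FirstOrder.Language

theorem exists_realize_term_eq {ι : Type*} [Fintype ι] (r : ℝ)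
    (t : letI := structureP r; (langP[[(Set.univ : Set ℤ)]]).Term ι) :
    ∃ (b : ι → ℤ) (c : ℤ), ∀ v : ι → ℤ,
      (letI := structureP r; t.realize v) = ∑ i, b i * v i + c := by
  classical
  let := structureP r
  induction t with
  | var i => exact ⟨Pi.single i 1, 0, fun v => by simp [Pi.single_apply]⟩
  | @func l f ts ih =>
    rcases f with f | f
    · cases f with
      | zero => exact ⟨0, 0, fun v => Eq.trans rfl (by simp : (0 : ℤ) = _)⟩
      | one => exact ⟨0, 1, fun v => Eq.trans rfl (by simp : (1 : ℤ) = _)⟩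
      | neg =>
        obtain ⟨b, c, h⟩ := ih 0
        refine ⟨-b, -c, fun v => (congrArg Neg.neg (h v)).trans ?_⟩
        simp only [Pi.neg_apply, neg_mul, Finset.sum_neg_distrib]
        ring
      | add =>
        obtain ⟨b, c, h⟩ := ih 0
        obtain ⟨b', c', h'⟩ := ih 1
        refine ⟨b + b', c + c', fun v => (congrArg₂ (· + ·) (h v) (h' v)).trans ?_⟩
        simp only [Pi.add_apply, add_mul, Finset.sum_add_distrib]
        ring
    · cases l with
      | zero => exact ⟨0, (f : (Set.univ : Set ℤ)), fun v =>
          Eq.trans rfl (by simp : ((f : (Set.univ : Set ℤ)) : ℤ) = _)⟩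
      | succ l => exact isEmptyElim (α := (constantsOn (Set.univ : Set ℤ)).Functions (l + 1)) f

theorem isTame_setOf_realize {r : ℝ} (hr : 1 < r) (hirr : Irrational r) {β : Type*} [Fintype β]
    {n : ℕ} (φ : letI := structureP r; (langP[[(Set.univ : Set ℤ)]]).BoundedFormula β n) :
    IsTame r⁻¹ {x : β ⊕ Fin n → ℤ |
      letI := structureP r; φ.Realize (x ∘ Sum.inl) (x ∘ Sum.inr)} := by
  let := structureP r
  have hα : Irrational r⁻¹ := hirr.inv
  have hα0 : 0 < r⁻¹ := inv_pos.2 (one_pos.trans hr)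
  induction φ with
  | falsum => exact ⟨1, one_pos, ∅, fun _ _ _ h => h⟩
  | equal t₁ t₂ =>
    obtain ⟨b₁, c₁, h₁⟩ := exists_realize_term_eq r t₁
    obtain ⟨b₂, c₂, h₂⟩ := exists_realize_term_eq r t₂
    convert isTame_eq_zero hα hα0 (b₁ - b₂) (c₁ - c₂) using 3 with x
    change t₁.realize (Sum.elim _ _) = t₂.realize (Sum.elim _ _) ↔ _
    rw [Sum.elim_comp_inl_inr, h₁, h₂, ← sub_eq_zero]
    simp only [Pi.sub_apply, sub_mul, Finset.sum_sub_distrib]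
    ring_nf
  | rel R ts =>
    rcases R with R | R
    · cases R with
      | P =>
        obtain ⟨b, c, h⟩ := exists_realize_term_eq r (ts 0)
        convert isTame_exists_translate hα0 (s := -1) (by decide) b c using 3 with x
        rw [← mem_beattySet_iff hr hirr, ← h]
        change (ts 0).realize (Sum.elim _ _) ∈ beattySet r ↔ _
        rw [Sum.elim_comp_inl_inr]
    · exact isEmptyElim R
  | imp φ ψ hφ hψ => exact hφ.imp hψ
  | all φ hφ => exact hφ.forall_extend hα

end Definable

end BeattyExpansion

theorem theorem1 (r : ℝ) (hr : 1 < r) (hirr : Irrational r) (X : Set ℤ) (hX : X.Infinite)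
    (hdef : BeattyExpansion.IsDefinable r X) :
    ∃ N : ℕ, 0 < N ∧ ∀ x ∈ X, ∃ k : ℕ, 1 ≤ k ∧ k ≤ N ∧ x + (k : ℤ) ∈ X := by
  let := BeattyExpansion.structureP r
  obtain ⟨φ, hφ⟩ := hdef
  have hmem : ∀ y : ℤ, y ∈ X ↔ (fun _ => y) ∈ {x : Fin 1 ⊕ Fin 0 → ℤ |
      FirstOrder.Language.BoundedFormula.Realize φ (x ∘ Sum.inl) (x ∘ Sum.inr)} := fun y => by
    have h : y ∈ X ↔ φ.Realize fun _ => y :=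
      Set.ext_iff.1 hφ fun _ => y
    rw [h, Set.mem_ofPred_eq, FirstOrder.Language.Formula.Realize]
    exact iff_of_eq (congrArg _ (Subsingleton.elim _ _))
  obtain ⟨N, hN⟩ := (BeattyExpansion.isTame_setOf_realize hr hirr φ).syndetic_of_infinite hirr.inv
    (hX.mono fun y hy => (hmem y).1 hy)
  refine ⟨N + 1, N.succ_pos, fun x _ => ?_⟩
  obtain ⟨k, h1, h2, h3⟩ := hN x
  lift k to ℕ using by omega
  exact ⟨k, by omega, by omega, (hmem _).2 h3⟩
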